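/- **Theorem 5.1.** *Extended metrics and Möbius spaces.* Let $Z$ be a set with $|Z|\ge 3$. An extended metric on $Z$ is a map $\rho:Z\times Z\to[0,\infty]$ for which there is a set $\Omega\subset Z$ with at most one point such that $\rho$ is a finite metric on $Z\setminus\Omega$, $\rho(z,\omega)=\rho(\omega,z)=\infty$ for $z\in Z\setminus\Omega$, $\omega\in\Omega$, and $\rho(\omega,\omega)=0$ for $\omega\in\Omega$. A quadruple in $Z^4$ is admissible if no entry occurs three or four times in it; its cross ratio triple is $$\mathrm{crt}_\rho(x,y,z,w)=(\rho(x,y)\rho(z,w):\rho(x,z)\rho(y,w):\rho(x,w)\rho(y,z))\in\mathbb{R}P^2,$$ where infinite distances cancel: e.g. if only $w\in\Omega$ the triple is $(\rho(x,y):\rho(x,z):\rho(y,z))$, and if $z=w\in\Omega$ it is $(0:1:1)$. Two extended metrics are Möbius equivalent if their cross ratio triples agree on all admissible quadruples. A Möbius structure $\mathcal M$ on $Z$ is a nonempty set of pairwise Möbius equivalent extended metrics on $Z$ that is maximal with this property; $(Z,\mathcal M)$ is then a Möbius space, and it is ultrametric if in every cross ratio triple $(a:b:c)$ with $a,b,c\ge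 0$ the two largest of the numbers $a,b,c$ coincide. *Antipodal diameter-1 metrics.* Let $\mathcal M^a_1$ be the set of those $\rho\in\mathcal M$ that are finite-valued, have diameter $\sup_{z,w}\rho(z,w)=1$, and for which every $z\in Z$ has some $z'\in Z$ with $\rho(z,z')=1$. For $\rho_1,\rho_2\in\mathcal M^a_1$ and $\zeta\in Z$ put $$\frac{d\rho_1}{d\rho_2}(\zeta)=\frac{\rho_1(\eta,\eta')}{\rho_1(\zeta,\eta)\rho_1(\zeta,\eta')}\cdot\frac{\rho_2(\zeta,\eta)\rho_2(\zeta,\eta')}{\rho_2(\eta,\eta')}$$ for any distinct $\eta,\eta'\in Z\setminus\{\zeta\}$ (the value does not depend on the choice), and $$d_{\mathcal M^a_1}(\rho_1,\rho_2)=\sup_{\zeta\in Z}\ln\frac{d\rho_1}{d\rho_2}(\zeta).$$ *Trees.* A tree is a metric space $(X,d)$ in which any two points $x,y$ are joined by a unique isometric map $[0,d(x,y)]\to X$ from $x$ to $y$, with image denoted $[x,y]$, and in which $[x,y]\cap[y,z]=\{y\}$ implies $[x,z]=[x,y]\cup[y,z]$. It is geodesically complete if every isometric map $[0,\ell]\to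 X$, $\ell>0$, extends to an isometric map $\mathbb R\to X$. Put $(x|y)_o=\frac12(d(o,x)+d(o,y)-d(x,y))$. The boundary $\partial_\infty X$ is the set of sequences $(x_i)$ in $X$ with $(x_i|x_j)_o\to\infty$ as $i,j\to\infty$, modulo the relation $(x_i|y_i)_o\to\infty$, for some basepoint $o$. For $x\in X$ and $a,b\in\partial_\infty X$ put $(a|b)_x=\lim_i(a_i|b_i)_x\in[0,\infty]$, where $(a_i),(b_i)$ represent $a,b$. The Bourdon metric at $x$ is $\rho_x(a,b)=e^{-(a|b)_x}$, with $e^{-\infty}=0$. The canonical Möbius structure $\mathcal M_X$ consists of all extended metrics on $\partial_\infty X$ that are Möbius equivalent to a Bourdon metric. *Statement.* Let $(Z,\mathcal M)$ be an ultrametric Möbius space and let $X$ be a geodesically complete tree with $(\partial_\infty X,\mathcal M_X)=(Z,\mathcal M)$, i.e. $\partial_\infty X$ is identified with $Z$ by a bijection that carries $\mathcal M_X$ onto $\mathcal M$. Then $x\mapsto\rho_x$, with $\rho_x$ regarded as a function on $Z\times Z$, is an isometry of $(X,d)$ onto $(\mathcal M^a_1,d_{\mathcal M^a_1})$: it is a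 bijection $X\to\mathcal M^a_1$, and $d_{\mathcal M^a_1}(\rho_x,\rho_y)=d(x,y)$ for all $x,y\in X$. -/

import Mathlib

open Filter Topology
open scoped ENNReal

namespace UltraMobius

noncomputable section

/-! ### Extended metrics and Möbius structures -/

section Mobius

variable {Z : Type*}

/-- `ρ : Z × Z → [0,∞]` is an extended metric: there is a set `Ω` with at most one point such that
`ρ` is a (finite) metric off `Ω`, the distance between a point off `Ω` and a point of `Ω`
is `∞`, and `ρ ω ω = 0` for `ω ∈ Ω`. -/
def IsExtMetric (ρ : Z → Z → ℝ≥0∞) : Prop :=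
  ∃ Ω : Set Z, Ω.Subsingleton ∧
    (∀ x ∉ Ω, ∀ y ∉ Ω, ρ x y ≠ ∞) ∧
    (∀ x ∉ Ω, ∀ y ∉ Ω, ρ x y = 0 ↔ x = y) ∧
    (∀ x ∉ Ω, ∀ y ∉ Ω, ρ x y = ρ y x) ∧
    (∀ x ∉ Ω, ∀ y ∉ Ω, ∀ z ∉ Ω, ρ x z ≤ ρ x y + ρ y z) ∧
    (∀ z ∉ Ω, ∀ ω ∈ Ω, ρ z ω = ∞ ∧ ρ ω z = ∞) ∧
    (∀ ω ∈ Ω, ρ ω ω = 0)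

/-- No entry occurs three or four times in the quadruple. -/
def Admissible (x y z w : Z) : Prop :=
  ¬ (x = y ∧ y = z) ∧ ¬ (x = y ∧ y = w) ∧ ¬ (x = z ∧ z = w) ∧ ¬ (y = z ∧ z = w)

/-- The factor contributed by the pair `(x, y)` to a homogeneous cross ratio triple: the infinite
distances to the remote point cancel, so they are replaced by `1`. -/
def factor (ρ : Z → Z → ℝ≥0∞) (x y : Z) : ℝ :=
  if ρ x y = ∞ then 1 else (ρ x y).toReal

/-- Homogeneous coordinates of the cross ratio triple
`(ρ(x,y)ρ(z,w) : ρ(x,z)ρ(y,w) : ρ(x,w)ρ(y,z))`. If the remote point occurs once, say `w = ω`,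
this is `(ρ(x,y) : ρ(x,z) : ρ(y,z))`; if it occurs twice, say `z = w = ω`, it is `(0 : 1 : 1)`. -/
def crt (ρ : Z → Z → ℝ≥0∞) (x y z w : Z) : Fin 3 → ℝ :=
  ![factor ρ x y * factor ρ z w, factor ρ x z * factor ρ y w, factor ρ x w * factor ρ y z]

/-- Two vectors of homogeneous coordinates represent the same point of the projective plane. -/
def SameProjectivePoint (v w : Fin 3 → ℝ) : Prop :=
  ∃ t : ℝ, t ≠ 0 ∧ w = t • v

/-- `ρ` and `ρ'` have the same cross ratio triples, i.e. the identity `(Z, ρ) → (Z, ρ')` is a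
Möbius map. -/
def MobiusEquivalent (ρ ρ' : Z → Z → ℝ≥0∞) : Prop :=
  ∀ x y z w : Z, Admissible x y z w → SameProjectivePoint (crt ρ x y z w) (crt ρ' x y z w)

/-- `(Z, M)` is a Möbius space: `Z` has at least three points and `M` is a nonempty set of pairwise
Möbius equivalent extended metrics on `Z`, maximal with respect to that property. -/
structure IsMobiusSpace (M : Set (Z → Z → ℝ≥0∞)) : Prop where
  three_points : ∃ x y z : Z, x ≠ y ∧ x ≠ z ∧ y ≠ z
  nonempty : M.Nonempty
  isExtMetric : ∀ ρ ∈ M, IsExtMetric ρ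
  equivalent : ∀ ρ ∈ M, ∀ ρ' ∈ M, MobiusEquivalent ρ ρ'
  maximal : ∀ ρ, IsExtMetric ρ → (∀ ρ' ∈ M, MobiusEquivalent ρ' ρ) → ρ ∈ M

/-- The two largest of three nonnegative numbers coincide. -/
def IsUltrametricTriple (v : Fin 3 → ℝ) : Prop :=
  (v 0 ≤ v 1 ∧ v 1 = v 2) ∨ (v 1 ≤ v 0 ∧ v 0 = v 2) ∨ (v 2 ≤ v 0 ∧ v 0 = v 1)

/-- All cross ratio triples of the Möbius structure are ultrametric. -/
def IsUltrametricStructure (M : Set (Z → Z → ℝ≥0∞)) : Prop :=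
  ∀ ρ ∈ M, ∀ x y z w : Z, Admissible x y z w → IsUltrametricTriple (crt ρ x y z w)

/-- `ρ` is a metric (without remote point) of diameter `1` in which every point has an
antipodal point. -/
structure IsAntipodalDiamOne (ρ : Z → Z → ℝ≥0∞) : Prop where
  isExtMetric : IsExtMetric ρ
  ne_top : ∀ x y, ρ x y ≠ ∞
  diam : ⨆ x, ⨆ y, ρ x y = 1
  antipodal : ∀ z, ∃ z', ρ z z' = 1

/-- The set of antipodal diameter one metrics in `M`. -/
def antipodalMetrics (M : Set (Z → Z → ℝ≥0∞)) : Set (Z → Z → ℝ≥0∞) :=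
  {ρ | ρ ∈ M ∧ IsAntipodalDiamOne ρ}

/-- The expression defining the derivative of `ρ₁` with respect to `ρ₂` at `ξ` by means of the
auxiliary points `η`, `η'`. -/
def derivExpr (ρ₁ ρ₂ : Z → Z → ℝ≥0∞) (ξ η η' : Z) : ℝ :=
  (ρ₁ η η').toReal / ((ρ₁ ξ η).toReal * (ρ₁ ξ η').toReal) *
    ((ρ₂ ξ η).toReal * (ρ₂ ξ η').toReal / (ρ₂ η η').toReal)

open Classical in
/-- The derivative `dρ₁/dρ₂` at `ξ`, computed with arbitrary distinct points `η, η' ≠ ξ`; see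
`metricDeriv_eq` for the independence of the choice. The value is `1` if there is no such pair,
which does not happen when `Z` has at least three points. -/
def metricDeriv (ρ₁ ρ₂ : Z → Z → ℝ≥0∞) (ξ : Z) : ℝ :=
  if h : ∃ p : Z × Z, p.1 ≠ ξ ∧ p.2 ≠ ξ ∧ p.1 ≠ p.2 then
    derivExpr ρ₁ ρ₂ ξ h.choose.1 h.choose.2
  else 1

/-- The distance `sup_ζ ln (dρ₁/dρ₂)(ζ)`, with values in the extended reals, so that no boundedness
is presupposed. -/
def biswasDist (ρ₁ ρ₂ : Z → Z → ℝ≥0∞) : EReal :=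
  ⨆ ζ : Z, ((Real.log (metricDeriv ρ₁ ρ₂ ζ) : ℝ) : EReal)

theorem toReal_pos {ρ : Z → Z → ℝ≥0∞} (h : IsExtMetric ρ) (hfin : ∀ x y, ρ x y ≠ ∞) {x y : Z}
    (hxy : x ≠ y) : 0 < (ρ x y).toReal := by
  obtain ⟨Ω, hsub, -, h0, -, -, hinf, -⟩ := h
  have hx : x ∉ Ω ∨ y ∉ Ω → x ∉ Ω ∧ y ∉ Ω := by
    rintro (hx | hy)
    · exact ⟨hx, fun hy => hfin _ _ (hinf x hx y hy).1⟩
    · exact ⟨fun hx => hfin _ _ (hinf y hy x hx).2, hy⟩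
  refine ENNReal.toReal_pos ?_ (hfin x y)
  by_cases hm : x ∉ Ω ∨ y ∉ Ω
  · exact fun h => hxy ((h0 x (hx hm).1 y (hx hm).2).1 h)
  · push Not at hm
    exact absurd (hsub hm.1 hm.2) hxy

theorem toReal_symm {ρ : Z → Z → ℝ≥0∞} (h : IsExtMetric ρ) (hfin : ∀ x y, ρ x y ≠ ∞) (x y : Z) :
    (ρ x y).toReal = (ρ y x).toReal := by
  obtain ⟨Ω, hsub, -, -, hs, -, hinf, -⟩ := h
  by_cases hx : x ∈ Ω
  · by_cases hy : y ∈ Ω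
    · rw [hsub hx hy]
    · exact absurd (hinf y hy x hx).1 (hfin _ _)
  · by_cases hy : y ∈ Ω
    · exact absurd (hinf x hx y hy).1 (hfin _ _)
    · rw [hs x hx y hy]

theorem derivExpr_symm {ρ₁ ρ₂ : Z → Z → ℝ≥0∞} (h₁ : IsExtMetric ρ₁) (h₂ : IsExtMetric ρ₂)
    (hf₁ : ∀ x y, ρ₁ x y ≠ ∞) (hf₂ : ∀ x y, ρ₂ x y ≠ ∞) (ξ η η' : Z) :
    derivExpr ρ₁ ρ₂ ξ η η' = derivExpr ρ₁ ρ₂ ξ η' η := by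
  unfold derivExpr
  rw [toReal_symm h₁ hf₁ η η', toReal_symm h₂ hf₂ η η', mul_comm (ρ₁ ξ η).toReal,
    mul_comm (ρ₂ ξ η).toReal]

theorem derivExpr_change {ρ₁ ρ₂ : Z → Z → ℝ≥0∞} (h₁ : IsExtMetric ρ₁) (h₂ : IsExtMetric ρ₂)
    (hf₁ : ∀ x y, ρ₁ x y ≠ ∞) (hf₂ : ∀ x y, ρ₂ x y ≠ ∞) (h : MobiusEquivalent ρ₁ ρ₂)
    {ξ η a b : Z} (hη : η ≠ ξ) (ha : a ≠ ξ) (hb : b ≠ ξ) (hηa : η ≠ a) (hηb : η ≠ b) :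
    derivExpr ρ₁ ρ₂ ξ η a = derivExpr ρ₁ ρ₂ ξ η b := by
  obtain ⟨t, ht, e⟩ := h ξ η a b ⟨fun h => hη h.1.symm, fun h => hη h.1.symm,
    fun h => ha h.1.symm, fun h => hηa h.1⟩
  have e1 := congrFun e 1
  have e2 := congrFun e 2
  simp only [crt, factor, hf₁, hf₂, if_false, Pi.smul_apply, smul_eq_mul, Matrix.cons_val] at e1 e2
  have p1 := toReal_pos h₁ hf₁ hη.symm
  have p2 := toReal_pos h₁ hf₁ ha.symm
  have p3 := toReal_pos h₁ hf₁ hb.symm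
  have p4 := toReal_pos h₁ hf₁ hηa
  have p5 := toReal_pos h₁ hf₁ hηb
  have q1 := toReal_pos h₂ hf₂ hη.symm
  have q2 := toReal_pos h₂ hf₂ ha.symm
  have q3 := toReal_pos h₂ hf₂ hb.symm
  have q4 := toReal_pos h₂ hf₂ hηa
  have q5 := toReal_pos h₂ hf₂ hηb
  unfold derivExpr
  generalize (ρ₁ ξ η).toReal = r1 at *
  generalize (ρ₁ ξ a).toReal = r2 at *
  generalize (ρ₁ ξ b).toReal = r3 at *
  generalize (ρ₁ η a).toReal = r4 at *
  generalize (ρ₁ η b).toReal = r5 at *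
  generalize (ρ₂ ξ η).toReal = s1 at *
  generalize (ρ₂ ξ a).toReal = s2 at *
  generalize (ρ₂ ξ b).toReal = s3 at *
  generalize (ρ₂ η a).toReal = s4 at *
  generalize (ρ₂ η b).toReal = s5 at *
  field_simp
  have key : t * ((s2 * s5) * (r3 * r4)) = t * ((r2 * r5) * (s3 * s4)) := by
    rw [e1, e2]; ring
  have := mul_left_cancel₀ ht key
  linarith

/-- The derivative does not depend on the choice of the auxiliary points. -/
theorem metricDeriv_eq {ρ₁ ρ₂ : Z → Z → ℝ≥0∞} (h₁ : IsExtMetric ρ₁) (h₂ : IsExtMetric ρ₂)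
    (hf₁ : ∀ x y, ρ₁ x y ≠ ∞) (hf₂ : ∀ x y, ρ₂ x y ≠ ∞) (h : MobiusEquivalent ρ₁ ρ₂)
    {ξ η η' : Z} (hη : η ≠ ξ) (hη' : η' ≠ ξ) (hne : η ≠ η') :
    metricDeriv ρ₁ ρ₂ ξ = derivExpr ρ₁ ρ₂ ξ η η' := by
  have hex : ∃ p : Z × Z, p.1 ≠ ξ ∧ p.2 ≠ ξ ∧ p.1 ≠ p.2 := ⟨(η, η'), hη, hη', hne⟩
  unfold metricDeriv
  rw [dif_pos hex]
  obtain ⟨h3, h4, h5⟩ := hex.choose_spec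
  generalize hex.choose.1 = a at *
  generalize hex.choose.2 = b at *
  have sw := derivExpr_symm h₁ h₂ hf₁ hf₂ ξ
  by_cases haη : a = η
  · subst haη
    exact derivExpr_change h₁ h₂ hf₁ hf₂ h h3 h4 hη' h5 hne
  · rw [derivExpr_change h₁ h₂ hf₁ hf₂ h h3 h4 hη h5 haη, sw a η]
    exact derivExpr_change h₁ h₂ hf₁ hf₂ h hη h3 hη' (Ne.symm haη) hne

end Mobius

/-! ### Metric trees -/

section Tree

variable {X : Type*} [MetricSpace X]

/-- `c : [0, d(x,y)] → X` is an isometric map from `x` to `y`. -/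
def IsGeodesic (x y : X) (c : Set.Icc (0 : ℝ) (dist x y) → X) : Prop :=
  Isometry c ∧ c ⟨0, le_rfl, dist_nonneg⟩ = x ∧ c ⟨dist x y, dist_nonneg, le_rfl⟩ = y

/-- The segment `[x,y]`: the image of the geodesic from `x` to `y`. -/
def geodSegment (x y : X) : Set X :=
  {p | ∃ c : Set.Icc (0 : ℝ) (dist x y) → X, IsGeodesic x y c ∧ p ∈ Set.range c}

variable (X) in
/-- A tree: a uniquely geodesic metric space in which two segments with exactly one common point,
an endpoint of both, form a segment. -/
structure IsMetricTree : Prop where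
  uniquely_geodesic : ∀ x y : X, ∃! c : Set.Icc (0 : ℝ) (dist x y) → X, IsGeodesic x y c
  segment_union : ∀ x y z : X, geodSegment x y ∩ geodSegment y z = {y} →
    geodSegment x z = geodSegment x y ∪ geodSegment y z

variable (X) in
/-- Every isometric map `[0,ℓ] → X`, `ℓ > 0`, extends to an isometric map `ℝ → X`. -/
def IsGeodesicallyComplete : Prop :=
  ∀ (ℓ : ℝ), 0 < ℓ → ∀ c : Set.Icc (0 : ℝ) ℓ → X, Isometry c →
    ∃ γ : ℝ → X, Isometry γ ∧ ∀ t : Set.Icc (0 : ℝ) ℓ, γ t = c t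

/-- The Gromov product `(x|y)_o`. -/
def gromovProduct (o x y : X) : ℝ :=
  (dist o x + dist o y - dist x y) / 2

variable (X) in
/-- Gromov sequences: `(uᵢ|uⱼ)_o → ∞` as `i, j → ∞`, for some basepoint `o`. -/
def GromovSeq : Type _ :=
  {u : ℕ → X // ∃ o : X, Tendsto (fun p : ℕ × ℕ => gromovProduct o (u p.1) (u p.2)) atTop atTop}

/-- `(uᵢ|vᵢ)_o → ∞` for some basepoint `o`. -/
def GromovSeq.Equivalent (u v : GromovSeq X) : Prop :=
  ∃ o : X, Tendsto (fun i : ℕ => gromovProduct o (u.1 i) (v.1 i)) atTop atTop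

variable (X) in
/-- The boundary at infinity: equivalence classes of Gromov sequences. (In a tree `Equivalent` is
already an equivalence relation.) -/
def Boundary : Type _ :=
  Quot (GromovSeq.Equivalent (X := X))

/-- The Gromov product `(a|b)_x` of boundary points, with value `∞` for `a = b`: the infimum of
`liminf (aᵢ|bᵢ)_x` over all sequences representing `a` and `b`. (In a tree the limit exists and is
the same for all such sequences, so this is the limit of `(aᵢ|bᵢ)_x`.) -/
def boundaryProduct (x : X) (a b : Boundary X) : EReal :=
  ⨅ (u : GromovSeq X) (v : GromovSeq X) (_ : Quot.mk _ u = a) (_ : Quot.mk _ v = b),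
    liminf (fun i : ℕ => ((gromovProduct x (u.1 i) (v.1 i) : ℝ) : EReal)) atTop

/-- The Bourdon metric `ρ_x(a,b) = exp(-(a|b)_x)`. -/
def bourdon (x : X) (a b : Boundary X) : ℝ≥0∞ :=
  EReal.exp (-(boundaryProduct x a b))

variable (X) in
/-- The canonical Möbius structure: all extended metrics on the boundary that are Möbius
equivalent to a Bourdon metric. -/
def canonicalStructure : Set (Boundary X → Boundary X → ℝ≥0∞) :=
  {ρ | IsExtMetric ρ ∧ ∃ x : X, MobiusEquivalent (bourdon x) ρ}

/-- The bijection `φ` identifies `(∂X, M_X)` with `(Z, M)`. -/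
def IsBoundaryIdentification {Z : Type*} (M : Set (Z → Z → ℝ≥0∞)) (φ : Boundary X ≃ Z) : Prop :=
  ∀ ρ : Z → Z → ℝ≥0∞, ρ ∈ M ↔ (fun a b => ρ (φ a) (φ b)) ∈ canonicalStructure X

/-- The Bourdon metric at `x`, as a function on `Z × Z`, where `Z` is identified with the
boundary by `φ`. -/
def bourdonOn {Z : Type*} (φ : Boundary X ≃ Z) (x : X) : Z → Z → ℝ≥0∞ :=
  fun z w => bourdon x (φ.symm z) (φ.symm w)

end Tree

end

end UltraMobius

open UltraMobius

/-! The tree is `0`-hyperbolic: two geodesics from `o` coincide up to the Gromov product of their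
endpoints and then separate. Hence among `(x|y)_o`, `(y|z)_o`, `(x|z)_o` the two smallest agree, and
along sequences converging to distinct ends the Gromov product is eventually constant. Every limit
at infinity therefore becomes an identity at some finite index.

Isometry: in `log (dρ_x/dρ_y)(ζ)` the auxiliary points cancel, leaving the Busemann difference
`d(x,u_i) - d(y,u_i)` for large `i`, where `u_i → ζ` (`log_derivExpr_bourdon`). It is at most
`d(x,y)` by the triangle inequality, with equality at the end of a line extending `[x,y]` beyond
`y`; such a line exists by geodesic completeness. Injectivity follows.

Surjectivity: given an antipodal `ρ`, take `ρ`-antipodes `a`, `a'` and a point on the line joining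
these ends. Sliding along the line keeps `a`, `a'` antipodal for the Bourdon metric and shifts the
log derivative at `a` by any prescribed real (`exists_shift`), so the derivative against `ρ` at `a`
can be made `1`. Rigidity (`eq_of_metricDeriv_eq_one`) finishes: ultrametricity puts every point at
distance `1` from `a` or `a'`, and the geometric mean value theorem then forces the derivative to be
`1` everywhere. -/

namespace UltraMobius

/-! ### Geodesics in metric trees and `0`-hyperbolicity -/

section Geodesics

variable {X : Type*} [MetricSpace X]

/-- A geodesic path from `x` to `y`, as a map on `ℝ` of which only the restriction to
`[0, dist x y]` matters. -/
structure IsGeodPath (g : ℝ → X) (x y : X) : Prop where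
  source : g 0 = x
  target : g (dist x y) = y
  dist_eq : ∀ s ∈ Set.Icc 0 (dist x y), ∀ t ∈ Set.Icc 0 (dist x y), dist (g s) (g t) = |s - t|

namespace IsGeodPath

variable {g h : ℝ → X} {x y : X} {t : ℝ}

theorem dist_source (hg : IsGeodPath g x y) (ht : t ∈ Set.Icc 0 (dist x y)) :
    dist x (g t) = t := by
  have := hg.dist_eq 0 ⟨le_rfl, dist_nonneg⟩ t ht
  rwa [hg.source, zero_sub, abs_neg, abs_of_nonneg ht.1] at this

theorem dist_target (hg : IsGeodPath g x y) (ht : t ∈ Set.Icc 0 (dist x y)) :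
    dist (g t) y = dist x y - t := by
  have := hg.dist_eq t ht (dist x y) ⟨dist_nonneg, le_rfl⟩
  rwa [hg.target, abs_sub_comm, abs_of_nonneg (sub_nonneg.2 ht.2)] at this

theorem isGeodesic (hg : IsGeodPath g x y) : IsGeodesic x y (fun t => g t) :=
  ⟨Isometry.of_dist_eq fun s t => by rw [hg.dist_eq s s.2 t t.2, Subtype.dist_eq, Real.dist_eq],
    hg.source, hg.target⟩

theorem restrict (hg : IsGeodPath g x y) (ht : t ∈ Set.Icc 0 (dist x y)) :
    IsGeodPath g x (g t) := by
  have hd := hg.dist_source ht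
  refine ⟨hg.source, by rw [hd], fun s hs r hr => ?_⟩
  rw [hd] at hs hr
  exact hg.dist_eq s ⟨hs.1, hs.2.trans ht.2⟩ r ⟨hr.1, hr.2.trans ht.2⟩

theorem shift (hg : IsGeodPath g x y) (ht : t ∈ Set.Icc 0 (dist x y)) :
    IsGeodPath (fun s => g (t + s)) (g t) y := by
  have hd := hg.dist_target ht
  refine ⟨by simp, by simp [hd, hg.target], fun s hs r hr => ?_⟩
  rw [hd] at hs hr
  rw [hg.dist_eq _ ⟨by linarith [ht.1, hs.1], by linarith [hs.2]⟩ _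
    ⟨by linarith [ht.1, hr.1], by linarith [hr.2]⟩, add_sub_add_left_eq_sub]

theorem reverse (hg : IsGeodPath g x y) : IsGeodPath (fun s => g (dist x y - s)) y x := by
  refine ⟨by simp [hg.target], by simp [dist_comm y x, hg.source], fun s hs r hr => ?_⟩
  rw [dist_comm] at hs hr
  rw [hg.dist_eq _ ⟨by linarith [hs.2], by linarith [hs.1]⟩ _
    ⟨by linarith [hr.2], by linarith [hr.1]⟩, sub_sub_sub_cancel_left, abs_sub_comm]

theorem eq_on (hX : IsMetricTree X) (hg : IsGeodPath g x y) (hh : IsGeodPath h x y)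
    (ht : t ∈ Set.Icc 0 (dist x y)) : g t = h t :=
  congrFun ((hX.uniquely_geodesic x y).unique hg.isGeodesic hh.isGeodesic) ⟨t, ht⟩

theorem mem_geodSegment (hX : IsMetricTree X) (hg : IsGeodPath g x y) {p : X} :
    p ∈ geodSegment x y ↔ ∃ t ∈ Set.Icc 0 (dist x y), g t = p := by
  constructor
  · rintro ⟨c, hc, s, rfl⟩
    exact ⟨s, s.2, congrFun ((hX.uniquely_geodesic x y).unique hg.isGeodesic hc) s⟩
  · rintro ⟨t, ht, rfl⟩
    exact ⟨_, hg.isGeodesic, ⟨t, ht⟩, rfl⟩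

theorem continuousOn (hg : IsGeodPath g x y) : ContinuousOn g (Set.Icc 0 (dist x y)) := by
  rw [continuousOn_iff_continuous_domRestrict]
  exact hg.isGeodesic.1.continuous

end IsGeodPath

theorem IsMetricTree.exists_geodPath (hX : IsMetricTree X) (x y : X) :
    ∃ g : ℝ → X, IsGeodPath g x y := by
  obtain ⟨c, ⟨hc, h0, h1⟩, -⟩ := hX.uniquely_geodesic x y
  have hext : ∀ s, (hs : s ∈ Set.Icc 0 (dist x y)) →
      Set.IccExtend dist_nonneg c s = c ⟨s, hs⟩ := fun s hs => Set.IccExtend_of_mem _ _ hs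
  refine ⟨Set.IccExtend dist_nonneg c, ?_, ?_, fun s hs t ht => ?_⟩
  · rw [hext _ ⟨le_rfl, dist_nonneg⟩, h0]
  · rw [hext _ ⟨dist_nonneg, le_rfl⟩, h1]
  · rw [hext s hs, hext t ht, hc.dist_eq, Subtype.dist_eq, Real.dist_eq]

theorem gromovProduct_comm (o x y : X) : gromovProduct o x y = gromovProduct o y x := by
  unfold gromovProduct
  rw [dist_comm x y, add_comm (dist o x)]

theorem gromovProduct_nonneg (o x y : X) : 0 ≤ gromovProduct o x y := by
  unfold gromovProduct
  linarith [dist_triangle_left x y o]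

theorem gromovProduct_le_left (o x y : X) : gromovProduct o x y ≤ dist o x := by
  unfold gromovProduct
  linarith [dist_triangle o x y]

theorem gromovProduct_le_right (o x y : X) : gromovProduct o x y ≤ dist o y :=
  gromovProduct_comm o x y ▸ gromovProduct_le_left o y x

theorem gromovProduct_sub_dist_le (o p x y : X) :
    gromovProduct o x y - dist o p ≤ gromovProduct p x y := by
  unfold gromovProduct
  linarith [dist_triangle o p x, dist_triangle o p y]

/-- Two geodesics with the same origin agree up to the Gromov product of their endpoints. -/
theorem IsMetricTree.eq_of_le_gromovProduct (hX : IsMetricTree X) {o x y : X} {g h : ℝ → X}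
    (hg : IsGeodPath g o x) (hh : IsGeodPath h o y) {t : ℝ} (ht : 0 ≤ t)
    (hle : t ≤ gromovProduct o x y) : g t = h t := by
  let m := min (dist o x) (dist o y)
  have hm : (0 : ℝ) ≤ m := le_min dist_nonneg dist_nonneg
  have hmx : Set.Icc 0 m ⊆ Set.Icc 0 (dist o x) := Set.Icc_subset_Icc_right (min_le_left _ _)
  have hmy : Set.Icc 0 m ⊆ Set.Icc 0 (dist o y) := Set.Icc_subset_Icc_right (min_le_right _ _)
  -- `D` is the compact set of times at which the geodesics meet; its maximum `T` is the branching
  -- time.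
  let D : Set ℝ := {s ∈ Set.Icc 0 m | dist (g s) (h s) = 0}
  have hDc : IsCompact D := isCompact_Icc.of_isClosed_subset
    ((continuous_dist.comp_continuousOn
      ((hg.continuousOn.mono hmx).prodMk (hh.continuousOn.mono hmy))).preimage_isClosed_of_isClosed
      isClosed_Icc isClosed_singleton) fun _ hs => hs.1
  have hDn : D.Nonempty := ⟨0, ⟨le_rfl, hm⟩, by rw [hg.source, hh.source, dist_self]⟩
  obtain ⟨T, ⟨hT, hTd⟩, hTmax⟩ := hDc.exists_isGreatest hDn
  have hgh : g T = h T := dist_eq_zero.1 hTd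
  have hTx := hmx hT
  have hTy := hmy hT
  have hinter : geodSegment x (g T) ∩ geodSegment (g T) y = {g T} := by
    have h1 := (hg.shift hTx).reverse
    have h2 := hh.shift hTy
    rw [← hgh] at h2
    ext p
    rw [Set.mem_inter_iff, h1.mem_geodSegment hX, h2.mem_geodSegment hX, Set.mem_singleton_iff]
    constructor
    · rintro ⟨⟨s, hs, hsp⟩, r, hr, hrp⟩
      rw [dist_comm, hg.dist_target hTx] at hs
      rw [hgh, hh.dist_target hTy] at hr
      rw [hg.dist_target hTx] at hsp
      have hs' : T + (dist o x - T - s) ∈ Set.Icc 0 (dist o x) :=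
        ⟨by linarith [hs.2, hT.1], by linarith [hs.1]⟩
      have hr' : T + r ∈ Set.Icc 0 (dist o y) := ⟨by linarith [hr.1, hT.1], by linarith [hr.2]⟩
      have e1 := hg.dist_source hs'
      have e2 := hh.dist_source hr'
      rw [hsp] at e1
      rw [hrp] at e2
      -- A common point of the two remainders has the same distance from `o` along both geodesics,
      -- so its time lies in `D` and cannot exceed `T`.
      have e : T + r = T + (dist o x - T - s) := e2.symm.trans e1
      have hle := hTmax (a := T + r) ⟨⟨hr'.1, le_min (e ▸ hs'.2) hr'.2⟩, by
        rw [hrp, e, hsp, dist_self]⟩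
      have hr0 : r = 0 := le_antisymm (by linarith) hr.1
      rw [← hrp, hr0, add_zero, hgh]
    · rintro rfl
      refine ⟨⟨dist x (g T), ⟨dist_nonneg, le_rfl⟩, h1.target⟩, 0, ⟨le_rfl, dist_nonneg⟩, ?_⟩
      rw [add_zero, hgh]
  have hmem : g T ∈ geodSegment x y := by
    rw [hX.segment_union x (g T) y hinter]
    refine Or.inl ?_
    have h1 := (hg.shift hTx).reverse
    exact (h1.mem_geodSegment hX).2 ⟨dist x (g T), ⟨dist_nonneg, le_rfl⟩, h1.target⟩
  obtain ⟨k, hk⟩ := hX.exists_geodPath x y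
  obtain ⟨r, hr, hrT⟩ := (hk.mem_geodSegment hX).1 hmem
  have e1 := hk.dist_source hr
  have e2 := hk.dist_target hr
  have e3 := hg.dist_target hTx
  have e4 := hh.dist_target hTy
  rw [hrT] at e1 e2
  rw [← hgh] at e4
  rw [dist_comm] at e3
  -- Since `[x,y]` passes through `g T`, the branching time `T` equals `(x|y)_o`.
  have hTle : t ≤ T := by
    unfold gromovProduct at hle
    linarith
  have hh' := hh.restrict hTy
  rw [← hgh] at hh'
  refine (hg.restrict hTx).eq_on hX hh' ⟨ht, ?_⟩
  rwa [hg.dist_source hTx]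

/-- Metric trees are `0`-hyperbolic. -/
theorem IsMetricTree.min_le_gromovProduct (hX : IsMetricTree X) (o x y z : X) :
    min (gromovProduct o x y) (gromovProduct o y z) ≤ gromovProduct o x z := by
  obtain ⟨f, hf⟩ := hX.exists_geodPath o x
  obtain ⟨g, hg⟩ := hX.exists_geodPath o y
  obtain ⟨h, hh⟩ := hX.exists_geodPath o z
  set T := min (gromovProduct o x y) (gromovProduct o y z) with hT
  have h0 : 0 ≤ T := le_min (gromovProduct_nonneg _ _ _) (gromovProduct_nonneg _ _ _)
  have hxy : T ≤ gromovProduct o x y := min_le_left _ _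
  have hyz : T ≤ gromovProduct o y z := min_le_right _ _
  have e : f T = h T := (hX.eq_of_le_gromovProduct hf hg h0 hxy).trans
    (hX.eq_of_le_gromovProduct hg hh h0 hyz)
  have e1 := hf.dist_target ⟨h0, hxy.trans (gromovProduct_le_left _ _ _)⟩
  have e2 := hh.dist_target ⟨h0, hyz.trans (gromovProduct_le_right _ _ _)⟩
  rw [← e] at e2
  have := dist_triangle_left x z (f T)
  unfold gromovProduct
  linarith

/-- Two applications of `0`-hyperbolicity. This is the replacement rule used below: `x` may be
exchanged for any `x'` that stays with it beyond the point where `y` branches off. -/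
theorem IsMetricTree.gromovProduct_eq_of_lt (hX : IsMetricTree X) {o x x' y : X}
    (h : gromovProduct o x y < gromovProduct o x x') :
    gromovProduct o x' y = gromovProduct o x y := by
  have h1 := hX.min_le_gromovProduct o x x' y
  have h2 := hX.min_le_gromovProduct o x' x y
  rw [gromovProduct_comm o x' x] at h2
  rw [min_eq_right h.le] at h2
  rcases min_le_iff.1 h1 with h3 | h3
  · exact absurd h3 (not_le.2 h)
  · exact le_antisymm h3 h2

/-- A nondegenerate segment of a geodesically complete tree lies on a line. -/
theorem IsGeodesicallyComplete.exists_line (hX : IsMetricTree X)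
    (hXc : IsGeodesicallyComplete X) {x y : X} (hxy : x ≠ y) :
    ∃ γ : ℝ → X, Isometry γ ∧ γ 0 = x ∧ γ (dist x y) = y := by
  obtain ⟨g, hg⟩ := hX.exists_geodPath x y
  obtain ⟨γ, hγ, h⟩ := hXc _ (dist_pos.2 hxy) _ hg.isGeodesic.1
  exact ⟨γ, hγ, (h ⟨0, le_rfl, dist_nonneg⟩).trans hg.source,
    (h ⟨_, dist_nonneg, le_rfl⟩).trans hg.target⟩

end Geodesics
-- Gromov products and Bourdon metrics at infinity
section BoundaryAtInfinity

variable {X : Type*} [MetricSpace X]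

/-- The real-valued Gromov product of two sequences tends to infinity for one basepoint iff it does
for every basepoint. -/
theorem tendsto_gromovProduct_basepoint {ι : Type*} {l : Filter ι} {u v : ι → X} {o : X}
    (h : Tendsto (fun i => gromovProduct o (u i) (v i)) l atTop) (p : X) :
    Tendsto (fun i => gromovProduct p (u i) (v i)) l atTop :=
  tendsto_atTop_mono (fun i => gromovProduct_sub_dist_le o p (u i) (v i))
    (tendsto_atTop_add_const_right l (-dist o p) h)

namespace GromovSeq

theorem tendsto (u : GromovSeq X) (o : X) :
    Tendsto (fun p : ℕ × ℕ => gromovProduct o (u.1 p.1) (u.1 p.2)) atTop atTop :=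
  u.2.elim fun _ h => tendsto_gromovProduct_basepoint h o

theorem Equivalent.tendsto {u v : GromovSeq X} (h : u.Equivalent v) (o : X) :
    Tendsto (fun i : ℕ => gromovProduct o (u.1 i) (v.1 i)) atTop atTop :=
  h.elim fun _ h => tendsto_gromovProduct_basepoint h o

theorem equivalent_refl (u : GromovSeq X) : u.Equivalent u :=
  u.2.elim fun o h => ⟨o, h.comp tendsto_atTop_diagonal⟩

theorem Equivalent.symm {u v : GromovSeq X} (h : u.Equivalent v) : v.Equivalent u := by
  obtain ⟨o, h⟩ := h
  exact ⟨o, h.congr fun i => gromovProduct_comm _ _ _⟩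

theorem Equivalent.trans (hX : IsMetricTree X) {u v w : GromovSeq X} (h : u.Equivalent v)
    (h' : v.Equivalent w) : u.Equivalent w := by
  obtain ⟨o, h⟩ := h
  refine ⟨o, tendsto_atTop.2 fun K => ?_⟩
  filter_upwards [h.eventually_ge_atTop K, (h'.tendsto o).eventually_ge_atTop K] with i h1 h2
  exact (le_min h1 h2).trans (hX.min_le_gromovProduct o _ _ _)

/-- `0`-hyperbolicity makes the relation transitive, so the quotient identifies nothing beyond it.
-/
theorem mk_eq_iff (hX : IsMetricTree X) {u v : GromovSeq X} :
    (Quot.mk _ u : Boundary X) = Quot.mk _ v ↔ u.Equivalent v := by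
  refine ⟨fun h => ?_, fun h => Quot.sound h⟩
  have heq : Equivalence (GromovSeq.Equivalent (X := X)) :=
    ⟨equivalent_refl, Equivalent.symm, Equivalent.trans hX⟩
  exact heq.eqvGen_iff.1 (Quot.eqvGen_exact h)

theorem eventually_le (u : GromovSeq X) (o : X) (K : ℝ) :
    ∃ N, ∀ i ≥ N, ∀ j ≥ N, K ≤ gromovProduct o (u.1 i) (u.1 j) := by
  obtain ⟨⟨m, n⟩, h⟩ := eventually_atTop.1 ((u.tendsto o).eventually_ge_atTop K)
  exact ⟨max m n, fun i hi j hj =>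
    h (i, j) ⟨(le_max_left _ _).trans hi, (le_max_right _ _).trans hj⟩⟩

/-- The sequence running along an isometrically embedded line towards its positive end. -/
def ofLine (γ : ℝ → X) (hγ : Isometry γ) : GromovSeq X :=
  ⟨fun n => γ n, γ 0, by
    have hmin : Tendsto (fun p : ℕ × ℕ => ((min p.1 p.2 : ℕ) : ℝ)) atTop atTop := by
      refine tendsto_natCast_atTop_atTop.comp (tendsto_atTop.2 fun n => ?_)
      filter_upwards [eventually_ge_atTop ((n, n) : ℕ × ℕ)] with p hp
      exact le_min hp.1 hp.2
    refine hmin.congr fun p => ?_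
    unfold gromovProduct
    rw [hγ.dist_eq, hγ.dist_eq, hγ.dist_eq, Real.dist_eq, Real.dist_eq, Real.dist_eq, zero_sub,
      zero_sub, abs_neg, abs_neg, Nat.abs_cast, Nat.abs_cast, Nat.cast_min]
    rcases le_total (p.1 : ℝ) p.2 with h | h
    · rw [min_eq_left h, abs_sub_comm, abs_of_nonneg (sub_nonneg.2 h)]
      ring
    · rw [min_eq_right h, abs_of_nonneg (sub_nonneg.2 h)]
      ring⟩

end GromovSeq

theorem gromovProduct_eventually_eq_of_equivalent (hX : IsMetricTree X) {u u' v : GromovSeq X}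
    (h : u.Equivalent u') {o : X} {r : ℝ} (hr : ∀ᶠ i in atTop, gromovProduct o (u.1 i) (v.1 i) = r) :
    ∀ᶠ i in atTop, gromovProduct o (u'.1 i) (v.1 i) = r := by
  filter_upwards [hr, (h.tendsto o).eventually_gt_atTop r] with i h1 h2
  rw [← h1] at h2
  rw [hX.gromovProduct_eq_of_lt h2, h1]

/-- Inequivalence gives a bound `K` below which the product falls at arbitrarily late indices. Take
such an index `j` so late that each sequence has mutual products at least `K` from there on;
replacing first `u j` by `u i`, then `v j` by `v i`, leaves the product unchanged. -/
theorem exists_gromovProduct_eventually_eq (hX : IsMetricTree X) {u v : GromovSeq X}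
    (h : ¬ u.Equivalent v) (o : X) :
    ∃ r, ∀ᶠ i in atTop, gromovProduct o (u.1 i) (v.1 i) = r := by
  have hnt : ¬ Tendsto (fun i : ℕ => gromovProduct o (u.1 i) (v.1 i)) atTop atTop :=
    fun ht => h ⟨o, ht⟩
  simp only [tendsto_atTop, not_forall, not_eventually, not_le] at hnt
  obtain ⟨K, hK⟩ := hnt
  obtain ⟨N, hN⟩ := u.eventually_le o K
  obtain ⟨N', hN'⟩ := v.eventually_le o K
  obtain ⟨j, hj, hlt⟩ := frequently_atTop.1 hK (max N N')
  have hjN := (le_max_left _ _).trans hj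
  have hjN' := (le_max_right _ _).trans hj
  refine ⟨gromovProduct o (u.1 j) (v.1 j), eventually_atTop.2 ⟨max N N', fun i hi => ?_⟩⟩
  have e1 := hX.gromovProduct_eq_of_lt (hlt.trans_le (hN j hjN i ((le_max_left _ _).trans hi)))
  have hlt' : gromovProduct o (v.1 j) (u.1 i) < gromovProduct o (v.1 j) (v.1 i) := by
    rw [gromovProduct_comm, e1]
    exact hlt.trans_le (hN' j hjN' i ((le_max_right _ _).trans hi))
  have e2 := hX.gromovProduct_eq_of_lt hlt'
  rw [gromovProduct_comm, e2, gromovProduct_comm, e1]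

theorem exists_gromovProduct_eventually_eq_forall (hX : IsMetricTree X) {a b : Boundary X}
    (hab : a ≠ b) (o : X) :
    ∃ r, ∀ u v : GromovSeq X, Quot.mk _ u = a → Quot.mk _ v = b →
      ∀ᶠ i in atTop, gromovProduct o (u.1 i) (v.1 i) = r := by
  obtain ⟨u, rfl⟩ := Quot.exists_rep a
  obtain ⟨v, rfl⟩ := Quot.exists_rep b
  obtain ⟨r, hr⟩ := exists_gromovProduct_eventually_eq hX
    (fun h => hab (Quot.sound h) : ¬ u.Equivalent v) o
  refine ⟨r, fun u' v' hu hv => ?_⟩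
  have h1 := gromovProduct_eventually_eq_of_equivalent hX ((GromovSeq.mk_eq_iff hX).1 hu).symm hr
  have h2 := gromovProduct_eventually_eq_of_equivalent hX ((GromovSeq.mk_eq_iff hX).1 hv).symm
    (h1.mono fun i hi => by rwa [gromovProduct_comm] : ∀ᶠ i in atTop,
      gromovProduct o (v.1 i) (u'.1 i) = r)
  exact h2.mono fun i hi => by rwa [gromovProduct_comm]

/-- Once all representatives give the same limit, the infimum and the `liminf` in `boundaryProduct`
play no role. -/
theorem boundaryProduct_eq_of_forall {o : X} {a b : Boundary X} {r : EReal}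
    (h : ∀ u v : GromovSeq X, Quot.mk _ u = a → Quot.mk _ v = b →
      Tendsto (fun i : ℕ => ((gromovProduct o (u.1 i) (v.1 i) : ℝ) : EReal)) atTop (𝓝 r)) :
    boundaryProduct o a b = r := by
  obtain ⟨u, hu⟩ := Quot.exists_rep a
  obtain ⟨v, hv⟩ := Quot.exists_rep b
  refine le_antisymm ?_ ?_
  · refine (iInf₂_le u v).trans ((iInf₂_le hu hv).trans ?_)
    rw [(h u v hu hv).liminf_eq]
  · refine le_iInf fun u' => le_iInf fun v' => le_iInf fun hu' => le_iInf fun hv' => ?_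
    rw [(h u' v' hu' hv').liminf_eq]

theorem bourdon_self (hX : IsMetricTree X) (o : X) (a : Boundary X) : bourdon o a a = 0 := by
  have : boundaryProduct o a a = ⊤ := boundaryProduct_eq_of_forall fun u v hu hv =>
    EReal.tendsto_coe_nhds_top_iff.2 (((GromovSeq.mk_eq_iff hX).1 (hu.trans hv.symm)).tendsto o)
  rw [bourdon, this, EReal.neg_top, EReal.exp_bot]

/-- Off the diagonal the Bourdon metric is computed by an eventually constant Gromov product. -/
theorem exists_bourdon_eq (hX : IsMetricTree X) {a b : Boundary X} (hab : a ≠ b) (o : X) :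
    ∃ r, bourdon o a b = ENNReal.ofReal (Real.exp (-r)) ∧
      ∀ u v : GromovSeq X, Quot.mk _ u = a → Quot.mk _ v = b →
        ∀ᶠ i in atTop, gromovProduct o (u.1 i) (v.1 i) = r := by
  obtain ⟨r, hr⟩ := exists_gromovProduct_eventually_eq_forall hX hab o
  refine ⟨r, ?_, hr⟩
  have : boundaryProduct o a b = (r : EReal) := boundaryProduct_eq_of_forall fun u v hu hv =>
    tendsto_const_nhds.congr' ((hr u v hu hv).mono fun i hi => congrArg Real.toEReal hi.symm)
  rw [bourdon, this, ← EReal.coe_neg, EReal.exp_coe]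

theorem bourdon_eq_of_eventually (hX : IsMetricTree X) {u v : GromovSeq X} {o : X} {r : ℝ}
    (h : ∀ᶠ i in atTop, gromovProduct o (u.1 i) (v.1 i) = r) :
    bourdon o (Quot.mk _ u) (Quot.mk _ v) = ENNReal.ofReal (Real.exp (-r)) := by
  have hne : (Quot.mk _ u : Boundary X) ≠ Quot.mk _ v := by
    intro he
    obtain ⟨i, h1, h2⟩ := (h.and
      ((((GromovSeq.mk_eq_iff hX).1 he).tendsto o).eventually_gt_atTop r)).exists
    exact h2.ne' h1
  obtain ⟨s, hs, hs'⟩ := exists_bourdon_eq hX hne o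
  obtain ⟨i, h1, h2⟩ := (h.and (hs' u v rfl rfl)).exists
  rw [hs, ← h2, h1]

theorem bourdon_le_one (hX : IsMetricTree X) (o : X) (a b : Boundary X) : bourdon o a b ≤ 1 := by
  by_cases hab : a = b
  · rw [hab, bourdon_self hX]
    exact zero_le_one
  · obtain ⟨r, hr, h⟩ := exists_bourdon_eq hX hab o
    obtain ⟨u, hu⟩ := Quot.exists_rep a
    obtain ⟨v, hv⟩ := Quot.exists_rep b
    obtain ⟨i, hi⟩ := (h u v hu hv).exists
    rw [hr, ENNReal.ofReal_le_one, Real.exp_le_one_iff, neg_nonpos, ← hi]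
    exact gromovProduct_nonneg _ _ _

theorem bourdon_eq_zero_iff (hX : IsMetricTree X) {o : X} {a b : Boundary X} :
    bourdon o a b = 0 ↔ a = b := by
  refine ⟨fun h => ?_, fun h => h ▸ bourdon_self hX o a⟩
  by_contra hab
  obtain ⟨r, hr, -⟩ := exists_bourdon_eq hX hab o
  rw [hr, ENNReal.ofReal_eq_zero] at h
  exact h.not_gt (Real.exp_pos _)

theorem bourdon_comm (hX : IsMetricTree X) (o : X) (a b : Boundary X) :
    bourdon o a b = bourdon o b a := by
  by_cases hab : a = b
  · rw [hab]
  · obtain ⟨r, hr, h⟩ := exists_bourdon_eq hX hab o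
    obtain ⟨u, rfl⟩ := Quot.exists_rep a
    obtain ⟨v, rfl⟩ := Quot.exists_rep b
    rw [hr]
    exact (bourdon_eq_of_eventually hX ((h u v rfl rfl).mono fun i hi => by
      rwa [gromovProduct_comm])).symm

theorem bourdon_le_max (hX : IsMetricTree X) (o : X) (a b c : Boundary X) :
    bourdon o a c ≤ max (bourdon o a b) (bourdon o b c) := by
  by_cases hab : a = b
  · exact hab ▸ le_max_right _ _
  by_cases hbc : b = c
  · exact hbc ▸ le_max_left _ _
  by_cases hac : a = c
  · rw [hac, bourdon_self hX]
    exact zero_le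
  obtain ⟨r, hr, h⟩ := exists_bourdon_eq hX hab o
  obtain ⟨r', hr', h'⟩ := exists_bourdon_eq hX hbc o
  obtain ⟨s, hs, h''⟩ := exists_bourdon_eq hX hac o
  obtain ⟨u, hu⟩ := Quot.exists_rep a
  obtain ⟨v, hv⟩ := Quot.exists_rep b
  obtain ⟨w, hw⟩ := Quot.exists_rep c
  obtain ⟨i, ⟨h1, h2⟩, h3⟩ := (((h u v hu hv).and (h' v w hv hw)).and (h'' u w hu hw)).exists
  have := hX.min_le_gromovProduct o (u.1 i) (v.1 i) (w.1 i)
  rw [h1, h2, h3] at this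
  rw [hr, hr', hs, le_max_iff]
  exact (min_le_iff.1 this).imp
    (fun h => ENNReal.ofReal_le_ofReal (Real.exp_le_exp.2 (neg_le_neg h)))
    (fun h => ENNReal.ofReal_le_ofReal (Real.exp_le_exp.2 (neg_le_neg h)))

theorem bourdon_ne_top (hX : IsMetricTree X) (o : X) (a b : Boundary X) : bourdon o a b ≠ ∞ :=
  ((bourdon_le_one hX o a b).trans_lt ENNReal.one_lt_top).ne

theorem isExtMetric_bourdon (hX : IsMetricTree X) (o : X) : IsExtMetric (bourdon o) := by
  refine ⟨∅, Set.subsingleton_empty, fun x _ y _ => bourdon_ne_top hX o x y,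
    fun x _ y _ => bourdon_eq_zero_iff hX, fun x _ y _ => bourdon_comm hX o x y,
    fun x _ y _ z _ => (bourdon_le_max hX o x y z).trans (max_le le_self_add le_add_self),
    fun _ _ _ h => h.elim, fun _ h => h.elim⟩

/-- In a geodesically complete tree every boundary point has an antipode. -/
theorem exists_bourdon_eq_one (hX : IsMetricTree X) (hXc : IsGeodesicallyComplete X) (o : X)
    (a : Boundary X) : ∃ b, bourdon o a b = 1 := by
  obtain ⟨u, rfl⟩ := Quot.exists_rep a
  -- Any positive constant would do: it makes `u N` differ from `o` and keeps later `u i` on the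
  -- same side of `o`. The antipode is the backward end of a line from `o` through `u N`.
  obtain ⟨N, hN⟩ := u.eventually_le o 1
  have hd : 1 ≤ dist o (u.1 N) :=
    (hN N le_rfl N le_rfl).trans (gromovProduct_le_left _ _ _)
  obtain ⟨γ, hγ, h0, h1⟩ := hXc.exists_line hX (dist_pos.1 (one_pos.trans_le hd))
  refine ⟨Quot.mk _ (GromovSeq.ofLine (fun t => γ (-t)) (hγ.comp (IsometryEquiv.neg ℝ).isometry)), ?_⟩
  have hz : ∀ n : ℕ, gromovProduct o (u.1 N) (γ (-n)) = 0 := by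
    intro n
    have e1 : dist o (γ (-n)) = n := by
      rw [← h0, hγ.dist_eq, Real.dist_eq, zero_sub, neg_neg, Nat.abs_cast]
    have e2 : dist (u.1 N) (γ (-n)) = dist o (u.1 N) + n := by
      nth_rw 1 [← h1]
      rw [hγ.dist_eq, Real.dist_eq, sub_neg_eq_add, abs_of_nonneg (by positivity)]
    unfold gromovProduct
    rw [e1, e2]
    ring
  have := bourdon_eq_of_eventually hX (o := o) (r := 0) (u := u)
    (v := GromovSeq.ofLine (fun t => γ (-t)) (hγ.comp (IsometryEquiv.neg ℝ).isometry))
    (eventually_atTop.2 ⟨N, fun i hi => by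
      have hlt : gromovProduct o (u.1 N) (γ (-i)) < gromovProduct o (u.1 N) (u.1 i) := by
        rw [hz]
        exact one_pos.trans_le (hN N le_rfl i hi)
      exact (hX.gromovProduct_eq_of_lt hlt).trans (hz i)⟩)
  rw [this]
  simp

/-- The logarithmic derivative of Bourdon metrics is the Busemann function. -/
theorem log_derivExpr_bourdon (hX : IsMetricTree X) (x y : X) {ζ η η' : Boundary X}
    (h1 : η ≠ ζ) (h2 : η' ≠ ζ) (h3 : η ≠ η') {u : GromovSeq X} (hu : Quot.mk _ u = ζ) :
    ∀ᶠ i in atTop, Real.log (derivExpr (bourdon x) (bourdon y) ζ η η') =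
      dist x (u.1 i) - dist y (u.1 i) := by
  obtain ⟨v, hv⟩ := Quot.exists_rep η
  obtain ⟨w, hw⟩ := Quot.exists_rep η'
  obtain ⟨r1, e1, H1⟩ := exists_bourdon_eq hX h1.symm x
  obtain ⟨r2, e2, H2⟩ := exists_bourdon_eq hX h2.symm x
  obtain ⟨r3, e3, H3⟩ := exists_bourdon_eq hX h3 x
  obtain ⟨s1, f1, I1⟩ := exists_bourdon_eq hX h1.symm y
  obtain ⟨s2, f2, I2⟩ := exists_bourdon_eq hX h2.symm y
  obtain ⟨s3, f3, I3⟩ := exists_bourdon_eq hX h3 y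
  -- In `(ζ|η) + (ζ|η') - (η|η')` the basepoint enters only through its distance to `ζ`; the mutual
  -- distances cancel between `x` and `y`.
  have hlog : Real.log (derivExpr (bourdon x) (bourdon y) ζ η η') =
      (r1 + r2 - r3) - (s1 + s2 - s3) := by
    unfold derivExpr
    rw [e1, e2, e3, f1, f2, f3]
    simp only [ENNReal.toReal_ofReal (Real.exp_pos _).le, ← Real.exp_add, ← Real.exp_sub]
    rw [Real.log_exp]
    ring
  filter_upwards [H1 u v hu hv, H2 u w hu hw, H3 v w hv hw, I1 u v hu hv, I2 u w hu hw,
    I3 v w hv hw] with i a1 a2 a3 b1 b2 b3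
  rw [hlog, ← a1, ← a2, ← a3, ← b1, ← b2, ← b3]
  unfold gromovProduct
  ring

/-- The point is the projection of `o` to a segment `[u m, v m]` with `m` large, which already
contains the relevant part of the line from `a` to `b`. -/
theorem exists_bourdon_eq_one_of_ne (hX : IsMetricTree X) [Nonempty X] {a b : Boundary X}
    (hab : a ≠ b) : ∃ p : X, bourdon p a b = 1 := by
  obtain ⟨o⟩ := ‹Nonempty X›
  obtain ⟨C, -, hC⟩ := exists_bourdon_eq hX hab o
  obtain ⟨u, rfl⟩ := Quot.exists_rep a
  obtain ⟨v, rfl⟩ := Quot.exists_rep b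
  obtain ⟨N, hN⟩ := eventually_atTop.1 (hC u v rfl rfl)
  -- Moving the basepoint from `o` to `p` costs at most `dist o p ≤ C`; the extra `1` keeps the
  -- products at `p` positive.
  obtain ⟨N₁, hN₁⟩ := u.eventually_le o (C + 1)
  obtain ⟨N₂, hN₂⟩ := v.eventually_le o (C + 1)
  let m := max N (max N₁ N₂)
  have hm : N ≤ m := le_max_left _ _
  have hm₁ : N₁ ≤ m := (le_max_left _ _).trans (le_max_right _ _)
  have hm₂ : N₂ ≤ m := (le_max_right _ _).trans (le_max_right _ _)
  obtain ⟨g, hg⟩ := hX.exists_geodPath (u.1 m) (v.1 m)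
  set t := gromovProduct (u.1 m) o (v.1 m) with htdef
  have ht : t ∈ Set.Icc 0 (dist (u.1 m) (v.1 m)) :=
    ⟨gromovProduct_nonneg _ _ _, gromovProduct_le_right _ _ _⟩
  have d1 := hg.dist_source ht
  have d2 := hg.dist_target ht
  set p := g t with hp
  have hop : dist o p ≤ C := by
    have hmin := hX.min_le_gromovProduct (u.1 m) o (v.1 m) p
    have hvp : gromovProduct (u.1 m) (v.1 m) p = t := by
      unfold gromovProduct
      rw [dist_comm (v.1 m) p, d1, d2]
      ring
    rw [hvp, ← htdef, min_self] at hmin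
    have := hN m hm
    unfold gromovProduct at this hmin htdef
    rw [dist_comm o (u.1 m)] at this
    linarith
  have hz : gromovProduct p (u.1 m) (v.1 m) = 0 := by
    unfold gromovProduct
    rw [dist_comm p (u.1 m), d1, d2]
    ring
  refine ⟨p, ?_⟩
  rw [bourdon_eq_of_eventually hX (r := 0) (eventually_atTop.2 ⟨m, fun i hi => ?_⟩)]
  · simp
  have h1 : gromovProduct p (u.1 m) (v.1 m) < gromovProduct p (u.1 m) (u.1 i) := by
    have := gromovProduct_sub_dist_le o p (u.1 m) (u.1 i)
    linarith [hN₁ m hm₁ i (hm₁.trans hi)]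
  have e1 := hX.gromovProduct_eq_of_lt h1
  have h2 : gromovProduct p (v.1 m) (u.1 i) < gromovProduct p (v.1 m) (v.1 i) := by
    rw [gromovProduct_comm, e1, hz]
    have := gromovProduct_sub_dist_le o p (v.1 m) (v.1 i)
    linarith [hN₂ m hm₂ i (hm₂.trans hi)]
  have e2 := hX.gromovProduct_eq_of_lt h2
  rw [gromovProduct_comm, e2, gromovProduct_comm, e1, hz]

/-- Moving along a line: from a point `p` on the line from `a` to `b` one can move by any `s ≥ 0`
towards `b`. -/
theorem exists_move (hX : IsMetricTree X) {u v : GromovSeq X} {p : X}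
    (h : bourdon p (Quot.mk _ u) (Quot.mk _ v) = 1) {s : ℝ} (hs : 0 ≤ s) :
    ∃ x : X, bourdon x (Quot.mk _ u) (Quot.mk _ v) = 1 ∧
      (∀ᶠ i in atTop, dist x (u.1 i) - dist p (u.1 i) = s) ∧
      ∀ᶠ i in atTop, dist x (v.1 i) - dist p (v.1 i) = -s := by
  rcases hs.eq_or_lt with rfl | hs0
  · exact ⟨p, h, by simp, by simp⟩
  have hne : (Quot.mk _ u : Boundary X) ≠ Quot.mk _ v := fun he => by
    rw [(bourdon_eq_zero_iff hX).2 he] at h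
    exact zero_ne_one h
  obtain ⟨r, hr, hr'⟩ := exists_bourdon_eq hX hne p
  have hr0 : r = 0 := by
    rw [h, eq_comm, ENNReal.ofReal_eq_one, Real.exp_eq_one_iff, neg_eq_zero] at hr
    exact hr
  subst hr0
  -- All geodesics from `p` to `v i`, `i ≥ N`, share their first stretch of length `s`; its end `g
  -- s` is the point sought.
  obtain ⟨N, hN⟩ := v.eventually_le p s
  have hd : s ≤ dist p (v.1 N) := (hN N le_rfl N le_rfl).trans (gromovProduct_le_left _ _ _)
  obtain ⟨g, hg⟩ := hX.exists_geodPath p (v.1 N)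
  have d1 := hg.dist_source ⟨hs, hd⟩
  have d2 := hg.dist_target ⟨hs, hd⟩
  have hxv : ∀ i ≥ N, s ≤ gromovProduct p (g s) (v.1 i) := fun i hi => by
    refine (le_min ?_ (hN N le_rfl i hi)).trans (hX.min_le_gromovProduct p (g s) (v.1 N) (v.1 i))
    unfold gromovProduct
    rw [d1, d2]
    linarith
  have hv : ∀ᶠ i in atTop, dist (g s) (v.1 i) - dist p (v.1 i) = -s := by
    filter_upwards [eventually_ge_atTop N] with i hi
    have h1 := hxv i hi
    have h2 := dist_triangle p (g s) (v.1 i)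
    unfold gromovProduct at h1
    linarith
  have hu : ∀ᶠ i in atTop, dist (g s) (u.1 i) - dist p (u.1 i) = s := by
    filter_upwards [eventually_ge_atTop N, hr' u v rfl rfl] with i hi h0
    have h1 := hX.min_le_gromovProduct p (g s) (u.1 i) (v.1 i)
    -- The direction to `u i` leaves `p` away from `v i`, hence away from `g s`; so `(g s|u i)_p =
    -- 0` and `p` lies between them. The strict inequality needs `s > 0`.
    have h2 : gromovProduct p (v.1 i) (u.1 i) < gromovProduct p (v.1 i) (g s) := by
      rw [gromovProduct_comm, h0, gromovProduct_comm]
      exact hs0.trans_le (hxv i hi)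
    have h3 := hX.gromovProduct_eq_of_lt h2
    rw [gromovProduct_comm p (v.1 i), h0] at h3
    unfold gromovProduct at h3
    linarith
  refine ⟨g s, ?_, hu, hv⟩
  rw [bourdon_eq_of_eventually hX (r := 0)]
  · simp
  filter_upwards [hu, hv, hr' u v rfl rfl] with i h1 h2 h3
  unfold gromovProduct at h3 ⊢
  linarith

/-- A negative shift is a move towards the other end, obtained by exchanging `u` and `v`. -/
theorem exists_shift (hX : IsMetricTree X) {u v : GromovSeq X} {p : X}
    (h : bourdon p (Quot.mk _ u) (Quot.mk _ v) = 1) (s : ℝ) :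
    ∃ x : X, bourdon x (Quot.mk _ u) (Quot.mk _ v) = 1 ∧
      (∀ᶠ i in atTop, dist x (u.1 i) - dist p (u.1 i) = s) ∧
      ∀ᶠ i in atTop, dist x (v.1 i) - dist p (v.1 i) = -s := by
  rcases le_total 0 s with hs | hs
  · exact exists_move hX h hs
  · obtain ⟨x, h1, h2, h3⟩ := exists_move hX ((bourdon_comm hX _ _ _).trans h) (neg_nonneg.2 hs)
    rw [neg_neg] at h3
    exact ⟨x, (bourdon_comm hX _ _ _).trans h1, h3, h2⟩

end BoundaryAtInfinity
-- Chain rule and geometric mean value theorem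
section Derivative

variable {Z : Type*} {ρ₁ ρ₂ ρ₃ : Z → Z → ℝ≥0∞}

theorem derivExpr_pos (h₁ : IsExtMetric ρ₁) (h₂ : IsExtMetric ρ₂) (hf₁ : ∀ x y, ρ₁ x y ≠ ∞)
    (hf₂ : ∀ x y, ρ₂ x y ≠ ∞) {ξ η η' : Z} (hη : η ≠ ξ) (hη' : η' ≠ ξ) (hne : η ≠ η') :
    0 < derivExpr ρ₁ ρ₂ ξ η η' := by
  have p1 := toReal_pos h₁ hf₁ hη.symm
  have p2 := toReal_pos h₁ hf₁ hη'.symm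
  have p3 := toReal_pos h₁ hf₁ hne
  have q1 := toReal_pos h₂ hf₂ hη.symm
  have q2 := toReal_pos h₂ hf₂ hη'.symm
  have q3 := toReal_pos h₂ hf₂ hne
  unfold derivExpr
  positivity

theorem derivExpr_trans (h₂ : IsExtMetric ρ₂) (hf₂ : ∀ x y, ρ₂ x y ≠ ∞) {ξ η η' : Z}
    (hη : η ≠ ξ) (hη' : η' ≠ ξ) (hne : η ≠ η') :
    derivExpr ρ₁ ρ₃ ξ η η' = derivExpr ρ₁ ρ₂ ξ η η' * derivExpr ρ₂ ρ₃ ξ η η' := by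
  have q1 := (toReal_pos h₂ hf₂ hη.symm).ne'
  have q2 := (toReal_pos h₂ hf₂ hη'.symm).ne'
  have q3 := (toReal_pos h₂ hf₂ hne).ne'
  unfold derivExpr
  field_simp

/-- The geometric mean value theorem. -/
theorem metricDeriv_mul_metricDeriv (h₁ : IsExtMetric ρ₁) (h₂ : IsExtMetric ρ₂)
    (hf₁ : ∀ x y, ρ₁ x y ≠ ∞) (hf₂ : ∀ x y, ρ₂ x y ≠ ∞) (h : MobiusEquivalent ρ₁ ρ₂)
    {ξ η ζ : Z} (hξη : ξ ≠ η) (hξζ : ξ ≠ ζ) (hηζ : η ≠ ζ) :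
    metricDeriv ρ₁ ρ₂ ξ * metricDeriv ρ₁ ρ₂ η * (ρ₁ ξ η).toReal ^ 2 = (ρ₂ ξ η).toReal ^ 2 := by
  -- With `ζ` as an auxiliary point on both sides, all distances to `ζ` cancel in the product.
  rw [metricDeriv_eq h₁ h₂ hf₁ hf₂ h hξη.symm hξζ.symm hηζ,
    metricDeriv_eq h₁ h₂ hf₁ hf₂ h hξη hηζ.symm hξζ]
  have p1 := (toReal_pos h₁ hf₁ hξη).ne'
  have p2 := (toReal_pos h₁ hf₁ hξζ).ne'
  have p3 := (toReal_pos h₁ hf₁ hηζ).ne'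
  have q1 := (toReal_pos h₂ hf₂ hξη).ne'
  have q2 := (toReal_pos h₂ hf₂ hξζ).ne'
  have q3 := (toReal_pos h₂ hf₂ hηζ).ne'
  unfold derivExpr
  rw [toReal_symm h₁ hf₁ η ξ, toReal_symm h₂ hf₂ η ξ]
  field_simp

end Derivative

/-! ### Rigidity of antipodal metrics -/

section Antipodal

variable {Z : Type*} {M : Set (Z → Z → ℝ≥0∞)} {ρ ρ₁ ρ₂ ρ₃ : Z → Z → ℝ≥0∞}

theorem IsAntipodalDiamOne.le_one (h : IsAntipodalDiamOne ρ) (x y : Z) : ρ x y ≤ 1 :=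
  h.diam ▸ le_iSup₂ (f := fun x y => ρ x y) x y

theorem IsAntipodalDiamOne.self (h : IsAntipodalDiamOne ρ) (x : Z) : ρ x x = 0 := by
  obtain ⟨Ω, -, -, h0, -, -, -, hΩ⟩ := h.isExtMetric
  by_cases hx : x ∈ Ω
  · exact hΩ x hx
  · exact (h0 x hx x hx).2 rfl

theorem IsAntipodalDiamOne.ne_of_eq_one (h : IsAntipodalDiamOne ρ) {x y : Z} (hxy : ρ x y = 1) :
    x ≠ y := by
  rintro rfl
  rw [h.self] at hxy
  exact zero_ne_one hxy

theorem IsMobiusSpace.exists_ne_ne (hM : IsMobiusSpace M) (z w : Z) : ∃ y, y ≠ z ∧ y ≠ w := by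
  obtain ⟨a, b, c, hab, hac, hbc⟩ := hM.three_points
  by_contra! h
  have ha := h a
  have hb := h b
  have hc := h c
  clear h
  grind +splitImp

/-- In an ultrametric Möbius space every point has distance one to one of two antipodes. -/
theorem eq_one_or_eq_one (hMu : IsUltrametricStructure M) (hρ : ρ ∈ antipodalMetrics M)
    {a a' : Z} (haa' : ρ a a' = 1) (b : Z) : ρ a b = 1 ∨ ρ a' b = 1 := by
  obtain ⟨hρM, hρ⟩ := hρ
  obtain ⟨b', hb'⟩ := hρ.antipodal b
  have ha := hρ.ne_of_eq_one haa'
  have hb := hρ.ne_of_eq_one hb'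
  have hadm : Admissible a a' b b' :=
    ⟨fun h => ha h.1, fun h => ha h.1, fun h => hb h.2, fun h => hb h.2⟩
  -- The first entry is `1` and the others are at most `1`, so another entry is also `1`; both its
  -- factors are then `1`, and one of them is `ρ a b` or `ρ a' b`.
  have hu := hMu ρ hρM a a' b b' hadm
  simp only [IsUltrametricTriple, crt, factor, hρ.ne_top, if_false, Matrix.cons_val, haa', hb',
    ENNReal.one_ne_top, ENNReal.toReal_one, mul_one] at hu
  have hle : ∀ x y, (ρ x y).toReal ≤ 1 := fun x y =>
    ENNReal.toReal_le_of_le_ofReal zero_le_one (by simpa using hρ.le_one x y)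
  have hone : ∀ x y z w, 1 ≤ (ρ x y).toReal * (ρ z w).toReal → ρ x y = 1 ∧ ρ z w = 1 := by
    intro x y z w h
    have key : ∀ s t : ℝ, 0 ≤ s → s ≤ 1 → 0 ≤ t → t ≤ 1 → 1 ≤ s * t → s = 1 ∧ t = 1 := by
      intro s t hs hs' ht ht' hst
      constructor <;> nlinarith
    obtain ⟨h1, h2⟩ := key _ _ ENNReal.toReal_nonneg (hle x y) ENNReal.toReal_nonneg (hle z w) h
    exact ⟨(ENNReal.toReal_eq_one_iff _).1 h1, (ENNReal.toReal_eq_one_iff _).1 h2⟩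
  rcases hu with ⟨h, -⟩ | ⟨-, h⟩ | ⟨-, h⟩
  · exact Or.inl (hone _ _ _ _ h).1
  · exact Or.inr (hone _ _ _ _ h.le).2
  · exact Or.inl (hone _ _ _ _ h.le).1

theorem metricDeriv_eq_derivExpr (hM : IsMobiusSpace M) (h₁ : ρ₁ ∈ antipodalMetrics M)
    (h₂ : ρ₂ ∈ antipodalMetrics M) {ξ η η' : Z} (hη : η ≠ ξ) (hη' : η' ≠ ξ) (hne : η ≠ η') :
    metricDeriv ρ₁ ρ₂ ξ = derivExpr ρ₁ ρ₂ ξ η η' :=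
  metricDeriv_eq h₁.2.isExtMetric h₂.2.isExtMetric h₁.2.ne_top h₂.2.ne_top
    (hM.equivalent _ h₁.1 _ h₂.1) hη hη' hne

theorem metricDeriv_pos (hM : IsMobiusSpace M) (h₁ : ρ₁ ∈ antipodalMetrics M)
    (h₂ : ρ₂ ∈ antipodalMetrics M) (ξ : Z) : 0 < metricDeriv ρ₁ ρ₂ ξ := by
  obtain ⟨η, hη, -⟩ := hM.exists_ne_ne ξ ξ
  obtain ⟨η', hη', hne⟩ := hM.exists_ne_ne ξ η
  rw [metricDeriv_eq_derivExpr hM h₁ h₂ hη hη' hne.symm]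
  exact derivExpr_pos h₁.2.isExtMetric h₂.2.isExtMetric h₁.2.ne_top h₂.2.ne_top hη hη' hne.symm

theorem metricDeriv_trans (hM : IsMobiusSpace M) (h₁ : ρ₁ ∈ antipodalMetrics M)
    (h₂ : ρ₂ ∈ antipodalMetrics M) (h₃ : ρ₃ ∈ antipodalMetrics M) (ξ : Z) :
    metricDeriv ρ₁ ρ₃ ξ = metricDeriv ρ₁ ρ₂ ξ * metricDeriv ρ₂ ρ₃ ξ := by
  obtain ⟨η, hη, -⟩ := hM.exists_ne_ne ξ ξ
  obtain ⟨η', hη', hne⟩ := hM.exists_ne_ne ξ η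
  rw [metricDeriv_eq_derivExpr hM h₁ h₃ hη hη' hne.symm,
    metricDeriv_eq_derivExpr hM h₁ h₂ hη hη' hne.symm,
    metricDeriv_eq_derivExpr hM h₂ h₃ hη hη' hne.symm]
  exact derivExpr_trans h₂.2.isExtMetric h₂.2.ne_top hη hη' hne.symm

/-- An antipodal metric is determined by a pair of antipodes and the derivative at one of them. -/
theorem eq_of_metricDeriv_eq_one (hM : IsMobiusSpace M) (hMu : IsUltrametricStructure M)
    (h₁ : ρ₁ ∈ antipodalMetrics M) (h₂ : ρ₂ ∈ antipodalMetrics M) {a a' : Z}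
    (e₁ : ρ₁ a a' = 1) (e₂ : ρ₂ a a' = 1) (hd : metricDeriv ρ₁ ρ₂ a = 1) : ρ₁ = ρ₂ := by
  have gm : ∀ {ξ η}, ξ ≠ η → metricDeriv ρ₁ ρ₂ ξ * metricDeriv ρ₁ ρ₂ η * (ρ₁ ξ η).toReal ^ 2 =
      (ρ₂ ξ η).toReal ^ 2 := by
    intro ξ η hne
    obtain ⟨ζ, hζ, hζ'⟩ := hM.exists_ne_ne ξ η
    exact metricDeriv_mul_metricDeriv h₁.2.isExtMetric h₂.2.isExtMetric h₁.2.ne_top h₂.2.ne_top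
      (hM.equivalent _ h₁.1 _ h₂.1) hne hζ.symm hζ'.symm
  have haa' : a ≠ a' := h₁.2.ne_of_eq_one e₁
  have hd' : metricDeriv ρ₁ ρ₂ a' = 1 := by
    simpa [e₁, e₂, hd] using gm haa'
  have hle : ∀ {ρ : Z → Z → ℝ≥0∞}, ρ ∈ antipodalMetrics M → ∀ x y, (ρ x y).toReal ^ 2 ≤ 1 :=
    fun h x y => pow_le_one₀ ENNReal.toReal_nonneg
      (ENNReal.toReal_le_of_le_ofReal zero_le_one (by simpa using h.2.le_one x y))
  have hone : ∀ b, metricDeriv ρ₁ ρ₂ b = 1 := by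
    intro b
    rcases eq_or_ne a b with rfl | hab
    · exact hd
    rcases eq_or_ne a' b with rfl | hab'
    · exact hd'
    have g1 := gm hab
    have g2 := gm hab'
    rw [hd, one_mul] at g1
    rw [hd', one_mul] at g2
    have hpos := metricDeriv_pos hM h₁ h₂ b
    -- Where `ρ₁` equals `1`, the derivative at `b` is a squared `ρ₂`-distance, hence at most `1`.
    -- Where `ρ₂` equals `1`, its product with a squared `ρ₁`-distance is `1`, hence it is at least
    -- `1`.
    refine le_antisymm ?_ ?_
    · rcases eq_one_or_eq_one hMu h₁ e₁ b with h | h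
      · rw [h, ENNReal.toReal_one, one_pow, mul_one] at g1
        exact g1 ▸ hle h₂ a b
      · rw [h, ENNReal.toReal_one, one_pow, mul_one] at g2
        exact g2 ▸ hle h₂ a' b
    · rcases eq_one_or_eq_one hMu h₂ e₂ b with h | h
      · rw [h, ENNReal.toReal_one, one_pow] at g1
        exact g1 ▸ mul_le_of_le_one_right hpos.le (hle h₁ a b)
      · rw [h, ENNReal.toReal_one, one_pow] at g2
        exact g2 ▸ mul_le_of_le_one_right hpos.le (hle h₁ a' b)
  funext b c
  rcases eq_or_ne b c with rfl | hbc
  · rw [h₁.2.self, h₂.2.self]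
  · have g := gm hbc
    rw [hone, hone, one_mul, one_mul,
      pow_left_inj₀ ENNReal.toReal_nonneg ENNReal.toReal_nonneg two_ne_zero] at g
    exact (ENNReal.toReal_eq_toReal_iff' (h₁.2.ne_top _ _) (h₂.2.ne_top _ _)).1 g

end Antipodal

/-! ### Bourdon metrics as antipodal metrics: isometry and surjectivity -/

section BourdonMetrics

variable {X : Type*} {Z : Type*} [MetricSpace X] {M : Set (Z → Z → ℝ≥0∞)} {φ : Boundary X ≃ Z}

theorem isExtMetric_bourdonOn (hX : IsMetricTree X) (φ : Boundary X ≃ Z) (x : X) :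
    IsExtMetric (bourdonOn φ x) := by
  refine ⟨∅, Set.subsingleton_empty, fun z _ w _ => bourdon_ne_top hX x _ _,
    fun z _ w _ => (bourdon_eq_zero_iff hX).trans φ.symm.injective.eq_iff,
    fun z _ w _ => bourdon_comm hX x _ _,
    fun z _ w _ v _ => (bourdon_le_max hX x _ (φ.symm w) _).trans
      (max_le le_self_add le_add_self),
    fun _ _ _ h => h.elim, fun _ h => h.elim⟩

theorem bourdonOn_mem (hX : IsMetricTree X) (hφ : IsBoundaryIdentification M φ) (x : X) :
    bourdonOn φ x ∈ M := by
  refine (hφ _).2 ?_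
  have : (fun a b => bourdonOn φ x (φ a) (φ b)) = bourdon x := by
    funext a b
    simp [bourdonOn]
  rw [this]
  exact ⟨isExtMetric_bourdon hX x, x, fun _ _ _ _ _ => ⟨1, one_ne_zero, (one_smul _ _).symm⟩⟩

theorem bourdonOn_mem_antipodalMetrics (hX : IsMetricTree X) (hXc : IsGeodesicallyComplete X)
    [Nonempty Z] (hφ : IsBoundaryIdentification M φ) (x : X) :
    bourdonOn φ x ∈ antipodalMetrics M := by
  have hanti : ∀ z, ∃ z', bourdonOn φ x z z' = 1 := by
    intro z
    obtain ⟨b, hb⟩ := exists_bourdon_eq_one hX hXc x (φ.symm z)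
    exact ⟨φ b, by rwa [bourdonOn, φ.symm_apply_apply]⟩
  refine ⟨bourdonOn_mem hX hφ x, isExtMetric_bourdonOn hX φ x,
    fun z w => bourdon_ne_top hX x _ _, le_antisymm ?_ ?_, hanti⟩
  · exact iSup₂_le fun z w => bourdon_le_one hX x _ _
  · obtain ⟨z⟩ := ‹Nonempty Z›
    obtain ⟨z', hz'⟩ := hanti z
    exact hz' ▸ le_iSup₂ (f := fun z w => bourdonOn φ x z w) z z'

theorem log_metricDeriv_bourdonOn (hX : IsMetricTree X) (hXc : IsGeodesicallyComplete X)
    (hM : IsMobiusSpace M) (hφ : IsBoundaryIdentification M φ) (x y : X) {z : Z}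
    {u : GromovSeq X} (hu : Quot.mk _ u = φ.symm z) :
    ∀ᶠ i in atTop, Real.log (metricDeriv (bourdonOn φ x) (bourdonOn φ y) z) =
      dist x (u.1 i) - dist y (u.1 i) := by
  have : Nonempty Z := ⟨z⟩
  obtain ⟨η, hη, -⟩ := hM.exists_ne_ne z z
  obtain ⟨η', hη', hne⟩ := hM.exists_ne_ne z η
  rw [metricDeriv_eq_derivExpr hM (bourdonOn_mem_antipodalMetrics hX hXc hφ x)
    (bourdonOn_mem_antipodalMetrics hX hXc hφ y) hη hη' hne.symm]
  exact log_derivExpr_bourdon hX x y (φ.symm.injective.ne hη) (φ.symm.injective.ne hη')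
    (φ.symm.injective.ne hne.symm) hu

theorem biswasDist_bourdonOn (hX : IsMetricTree X) (hXc : IsGeodesicallyComplete X)
    (hM : IsMobiusSpace M) (hφ : IsBoundaryIdentification M φ) (x y : X) :
    biswasDist (bourdonOn φ x) (bourdonOn φ y) = ((dist x y : ℝ) : EReal) := by
  have hlog := fun (z : Z) (u : GromovSeq X) (hu : Quot.mk _ u = φ.symm z) =>
    log_metricDeriv_bourdonOn hX hXc hM hφ x y hu
  refine le_antisymm (iSup_le fun z => ?_) ?_
  · obtain ⟨u, hu⟩ := Quot.exists_rep (φ.symm z)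
    obtain ⟨i, hi⟩ := (hlog z u hu).exists
    rw [hi, EReal.coe_le_coe_iff]
    linarith [dist_triangle x y (u.1 i)]
  · suffices h : ∃ u : GromovSeq X, ∀ᶠ i in atTop, dist x (u.1 i) - dist y (u.1 i) = dist x y by
      obtain ⟨u, hu⟩ := h
      obtain ⟨i, h1, h2⟩ := (hu.and (hlog (φ (Quot.mk _ u)) u (φ.symm_apply_apply _).symm)).exists
      rw [← h1, ← h2]
      exact le_iSup (fun ζ => ((Real.log (metricDeriv (bourdonOn φ x) (bourdonOn φ y) ζ) : ℝ) :
        EReal)) _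
    rcases eq_or_ne x y with rfl | hxy
    · obtain ⟨z, -⟩ := hM.three_points
      obtain ⟨u, -⟩ := Quot.exists_rep (φ.symm z)
      exact ⟨u, by simp⟩
    · obtain ⟨γ, hγ, h0, h1⟩ := hXc.exists_line hX hxy
      refine ⟨GromovSeq.ofLine γ hγ, ?_⟩
      -- From time `dist x y` on, the line has passed `y`, and the Busemann difference is exactly
      -- `dist x y`.
      filter_upwards [tendsto_natCast_atTop_atTop.eventually_ge_atTop (dist x y)] with i hi
      have e1 : dist x (γ i) = i := by
        rw [← h0, hγ.dist_eq, Real.dist_eq, zero_sub, abs_neg, Nat.abs_cast]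
      have e2 : dist y (γ i) = i - dist x y := by
        nth_rw 1 [← h1]
        rw [hγ.dist_eq, Real.dist_eq, abs_sub_comm, abs_of_nonneg (sub_nonneg.2 hi)]
      change dist x (γ i) - dist y (γ i) = dist x y
      rw [e1, e2, sub_sub_cancel]

theorem exists_bourdonOn_eq (hX : IsMetricTree X) (hXc : IsGeodesicallyComplete X)
    (hM : IsMobiusSpace M) (hMu : IsUltrametricStructure M) (hφ : IsBoundaryIdentification M φ)
    {ρ : Z → Z → ℝ≥0∞} (hρ : ρ ∈ antipodalMetrics M) : ∃ x, bourdonOn φ x = ρ := by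
  obtain ⟨a, -⟩ := hM.three_points
  have : Nonempty Z := ⟨a⟩
  obtain ⟨a', ha'⟩ := hρ.2.antipodal a
  have hne := hρ.2.ne_of_eq_one ha'
  obtain ⟨u, hu⟩ := Quot.exists_rep (φ.symm a)
  obtain ⟨v, hv⟩ := Quot.exists_rep (φ.symm a')
  have : Nonempty X := ⟨u.1 0⟩
  obtain ⟨p, hp⟩ := exists_bourdon_eq_one_of_ne hX (φ.symm.injective.ne hne)
  rw [← hu, ← hv] at hp
  -- The shift makes `dρ_x/dρ_p` at `a` the inverse of `dρ_p/dρ`, so the chain rule gives `dρ_x/dρ =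
  -- 1` there.
  obtain ⟨x, hx, hxu, -⟩ := exists_shift hX hp (-Real.log (metricDeriv (bourdonOn φ p) ρ a))
  have mem := bourdonOn_mem_antipodalMetrics hX hXc hφ
  refine ⟨x, eq_of_metricDeriv_eq_one hM hMu (mem x) hρ (a := a) (a' := a') ?_ ha' ?_⟩
  · rwa [hu, hv] at hx
  · obtain ⟨i, h1, h2⟩ := (hxu.and (log_metricDeriv_bourdonOn hX hXc hM hφ x p hu)).exists
    have hpos := metricDeriv_pos hM (mem p) hρ a
    rw [h1, ← Real.log_inv] at h2
    rw [metricDeriv_trans hM (mem x) (mem p) hρ,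
      Real.log_injOn_pos (metricDeriv_pos hM (mem x) (mem p) a) (inv_pos.2 hpos) h2,
      inv_mul_cancel₀ hpos.ne']

end BourdonMetrics
end UltraMobius

theorem theorem5p1 {X : Type*} {Z : Type*} [MetricSpace X]
    (hX : IsMetricTree X) (hXc : IsGeodesicallyComplete X)
    (M : Set (Z → Z → ℝ≥0∞)) (hM : IsMobiusSpace M) (hMu : IsUltrametricStructure M)
    (φ : Boundary X ≃ Z) (hφ : IsBoundaryIdentification M φ) :
    Set.BijOn (bourdonOn φ) Set.univ (antipodalMetrics M) ∧
      ∀ x y : X, biswasDist (bourdonOn φ x) (bourdonOn φ y) = ((dist x y : ℝ) : EReal) := by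
  have hdist := biswasDist_bourdonOn hX hXc hM hφ
  have : Nonempty Z := hM.three_points.nonempty
  refine ⟨⟨fun x _ => bourdonOn_mem_antipodalMetrics hX hXc hφ x, fun x _ y _ hxy => ?_,
    fun ρ hρ => ?_⟩, hdist⟩
  · have h := hdist x y
    rw [show bourdonOn φ x = bourdonOn φ y from hxy, hdist y y, dist_self, EReal.coe_eq_coe_iff] at h
    exact dist_eq_zero.1 h.symm
  · obtain ⟨x, hx⟩ := exists_bourdonOn_eq hX hXc hM hMu hφ hρ
    exact ⟨x, Set.mem_univ x, hx⟩
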